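/- Let $\mathbb{E}^n_\nu$ be a pseudo-Euclidean vector space, i.e. a finite-dimensional real vector space with a non-degenerate symmetric bilinear form $\langle\cdot,\cdot\rangle$; write $x^2=\langle x,x\rangle$. Let $\bar p\in\mathbb{E}^n_\nu$, let $\mathbb{E}^n_\nu=V_0\oplus V_1\oplus\cdots\oplus V_k$ ($k\ge 1$) be an orthogonal decomposition into non-trivial subspaces, let $a_1,\dots,a_k\in V_0$ be pairwise orthogonal, and put $\kappa_i=a_i^2$. Assume that one of the following holds: * (non-null case) $\kappa_i\neq 0$ for all $i$; then let $c_i=\bar p-\frac{a_i}{\kappa_i}$, $W_0=V_0\cap\operatorname{span}\{a_1,\dots,a_k\}^\perp$, $W_i=\mathbb{R}a_i\oplus V_i$ for $i\geq1$, and let $P_i$ be the orthogonal projection onto $W_i$ ($0\le i\le k$); * (null case) $k=1$ and $a:=a_1$ is lightlike ($a\ne0$, $a^2=0$); then for a lightlike $b\in V_0$ with $\langle a,b\rangle=1$ let $W_0=V_0\cap\operatorname{span}\{a,b\}^\perp$, and let $P_0,P_1$ be the orthogonal projections onto $W_0$ and $V_1$. Let $\rho_i(p_0)=1+\langle a_i,p_0-\bar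 p\rangle$, let $N_0$ be the set of $p_0\in\bar p+V_0$ with $\rho_i(p_0)>0$ for all $i$, and for $i\ge1$ let $N_i$ be the spherical submanifold determined by $(\bar p,V_i,a_i)$: $N_i=c_i+\{q\in W_i : q^2=1/\kappa_i\}$ if $\kappa_i\ne0$, and $N_i=\bar p+\{v-\frac12v^2a_i : v\in V_i\}$ if $a_i$ is lightlike. Let $\psi(p_0,\dots,p_k)=p_0+\sum_{i=1}^k\rho_i(p_0)(p_i-\bar p)$ on $N_0\times\cdots\times N_k$. Suppose these data are in canonical form: $\bar p\in V_0$ and $\langle\bar p,a_i\rangle=1$ for all $i$. Then: 1. $N_0=\{p\in V_0 : \langle a_i,p\rangle>0\text{ for all }i\}$, and $\rho_i(p_0)=\langle a_i,p_0\rangle$ for $p_0\in N_0$. 2. $\psi$ is an isometry (a diffeomorphism preserving the metric) from the warped product $N_0\times_{\rho_1}N_1\times\cdots\times_{\rho_k}N_k$, whose metric is $g_0+\sum_i\rho_i^2g_i$ with $g_i$ the induced metrics, onto its image, a non-empty open subset of $\mathbb{E}^n_\nu$, and $$\operatorname{Im}(\psi)=\begin{cases}\{p\in\mathbb{E}^n_\nu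 : \operatorname{sgn}(P_ip)^2=\operatorname{sgn}\kappa_i\text{ for each }i=1,\dots,k\}&\text{non-null case}\\ \{p\in\mathbb{E}^n_\nu : \langle a,p\rangle>0\}&\text{null case.}\end{cases}$$ 3. For $(p_0,\dots,p_k)\in N_0\times\cdots\times N_k$, in the non-null case $$\psi(p_0,\dots,p_k)=P_0p_0+\sum_{i=1}^k\langle a_i,p_0\rangle(p_i-c_i);$$ in the null case there is a lightlike $b\in V_0$ with $\langle a,b\rangle=1$, and for every such $b$ $$\psi(p_0,p_1)=P_0p_0+\Big(\langle b,p_0\rangle-\tfrac12\langle a,p_0\rangle(P_1p_1)^2\Big)a+\langle a,p_0\rangle b+\langle a,p_0\rangle P_1p_1.$$ 4. $\psi(p_0,\dots,p_k)^2=p_0^2$ for all $(p_0,\dots,p_k)\in N_0\times\cdots\times N_k$. -/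

import Mathlib

open scoped ContDiff

noncomputable section

namespace WarpedProduct

variable {E : Type*} [NormedAddCommGroup E] [NormedSpace ℝ E]

/-- The orthogonal projection onto a subspace `W` with respect to the symmetric form `g`, that is the
projection onto `W` along `W^⊥`. It exists exactly when `E = W ⊕ W^⊥`, e.g. when `W` is
non-degenerate; the value `0` is used otherwise. -/
def orthProj (g : LinearMap.BilinForm ℝ E) (W : Submodule ℝ E) : E →ₗ[ℝ] E :=
  open Classical in
  if h : IsCompl W (LinearMap.BilinForm.orthogonal g W) then
    W.projection (LinearMap.BilinForm.orthogonal g W) h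
  else 0

/-- The spherical submanifold of the pseudo-Euclidean space `(E, g)` determined by `(p, V, a)`:
the plane `p + V` if `a = 0`, the paraboloid `p + {v - v²/2 a | v ∈ V}` if `a` is lightlike, and the
hyperquadric `c + {q ∈ ℝ a ⊕ V | q² = 1/a²}` with center `c = p - a/a²` otherwise. -/
def sphericalSubmanifold (g : LinearMap.BilinForm ℝ E) (p : E) (V : Submodule ℝ E) (a : E) :
    Set E :=
  open Classical in
  if a = 0 then {x | ∃ v ∈ V, x = p + v}
  else if g a a = 0 then {x | ∃ v ∈ V, x = p + (v - ((1 / 2 : ℝ) * g v v) • a)}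
  else {x | ∃ q ∈ Submodule.span ℝ {a} ⊔ V,
    g q q = 1 / g a a ∧ x = (p - (1 / g a a) • a) + q}

/-- `v` is tangent at `x` to the subset `S` of a vector space: it is the velocity at time `0` of a
smooth curve in `S` that passes through `x` at time `0`. For an embedded submanifold `S` this is
membership in `T_x S`. -/
def IsTangentVector {F : Type*} [NormedAddCommGroup F] [NormedSpace ℝ F]
    (S : Set F) (x v : F) : Prop :=
  ∃ γ : ℝ → F, ContDiffAt ℝ ∞ γ 0 ∧ γ 0 = x ∧ (∀ᶠ t in nhds (0 : ℝ), γ t ∈ S) ∧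
    HasDerivAt γ v 0

/-- The smooth map `f` restricts to an isometry from the submanifold `S` of `F`, equipped with the
metric `h` (`h x` is the metric on `T_x S`), onto the open subset `U` of the pseudo-Euclidean
space `(E, g)`: it restricts to a bijection from `S` onto `U` with smooth inverse, and it pulls `g`
back to `h`. -/
def IsIsometryOnto {F : Type*} [NormedAddCommGroup F] [NormedSpace ℝ F]
    (g : LinearMap.BilinForm ℝ E) (h : F → F → F → ℝ) (f : F → E) (S : Set F) (U : Set E) : Prop :=
  IsOpen U ∧ Set.BijOn f S U ∧ ContDiff ℝ ∞ f ∧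
    (∃ φ : E → F, ContDiffOn ℝ ∞ φ U ∧ Set.InvOn φ f S U) ∧
    ∀ x ∈ S, ∀ v w : F, IsTangentVector S x v → IsTangentVector S x w →
      g (fderiv ℝ f x v) (fderiv ℝ f x w) = h x v w

/-- Initial data `(p̄; V_0 ⦹ ⋯ ⦹ V_k; a_1, …, a_k)` in the pseudo-Euclidean space `(E, g)`;
the vector `a_i` (`1 ≤ i ≤ k`) is `a j` and `V_i` is `V j.succ` for the corresponding
`j : Fin k`. -/
structure InitialData (g : LinearMap.BilinForm ℝ E) (k : ℕ) where
  one_le : 1 ≤ k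
  /-- The base point `p̄`. -/
  pt : E
  /-- The subspaces `V_0, …, V_k`. -/
  V : Fin (k + 1) → Submodule ℝ E
  /-- The vectors `a_1, …, a_k`. -/
  a : Fin k → E
  internal : DirectSum.IsInternal V
  orthogonal : ∀ i j, i ≠ j → ∀ x ∈ V i, ∀ y ∈ V j, g x y = 0
  nontrivial : ∀ i, V i ≠ ⊥
  a_mem : ∀ i, a i ∈ V 0
  a_orthogonal : ∀ i j, i ≠ j → g (a i) (a j) = 0

namespace InitialData

variable {g : LinearMap.BilinForm ℝ E} {k : ℕ} (D : InitialData g k)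

/-- `κ_i = a_i²`. -/
def kappa (i : Fin k) : ℝ := g (D.a i) (D.a i)

/-- Non-null case: no `a_i` is null. -/
def IsNonNull : Prop := ∀ i, D.kappa i ≠ 0

/-- Null case: `k = 1` and `a_1` is lightlike. -/
def IsNull : Prop := k = 1 ∧ ∀ i, D.a i ≠ 0 ∧ D.kappa i = 0

/-- Canonical form: `p̄ ∈ V_0` and `⟨p̄, a_i⟩ = 1`. -/
def IsCanonical : Prop := D.pt ∈ D.V 0 ∧ ∀ i, g D.pt (D.a i) = 1

/-- The warping function `ρ_i(p_0) = 1 + ⟨a_i, p_0 - p̄⟩`. -/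
def rho (i : Fin k) (p₀ : E) : ℝ := 1 + g (D.a i) (p₀ - D.pt)

/-- The geodesic factor `N_0`: the part of the plane `p̄ + V_0` where each `ρ_i` is positive. -/
def N₀ : Set E := {p | p ∈ sphericalSubmanifold g D.pt (D.V 0) 0 ∧ ∀ i, 0 < D.rho i p}

/-- The spherical factor `N_i`, determined by `(p̄, V_i, a_i)`. -/
def N (i : Fin k) : Set E := sphericalSubmanifold g D.pt (D.V i.succ) (D.a i)

/-- The product `N_0 × N_1 × ⋯ × N_k`. -/
def domain : Set (E × (Fin k → E)) := {x | x.1 ∈ D.N₀ ∧ ∀ i, x.2 i ∈ D.N i}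

/-- The metric of the warped product `N_0 ×_{ρ_1} N_1 × ⋯ ×_{ρ_k} N_k` at `x`. -/
def warpedMetric (x v w : E × (Fin k → E)) : ℝ :=
  g v.1 w.1 + ∑ i, D.rho i x.1 ^ 2 * g (v.2 i) (w.2 i)

/-- `ψ(p_0, …, p_k) = p_0 + ∑ ρ_i(p_0) (p_i - p̄)`; the warped product decomposition determined by
the data is the restriction of this map to `N_0 × ⋯ × N_k`. -/
def psi (x : E × (Fin k → E)) : E := x.1 + ∑ i, D.rho i x.1 • (x.2 i - D.pt)

/-- The image of the warped product decomposition. -/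
def image : Set E := D.psi '' D.domain

/-- `c_i = p̄ - a_i / κ_i`. -/
def c (i : Fin k) : E := D.pt - (1 / D.kappa i) • D.a i

/-- `W_i = ℝ a_i ⊕ V_i` for `1 ≤ i ≤ k` (non-null case). -/
def W (i : Fin k) : Submodule ℝ E := Submodule.span ℝ {D.a i} ⊔ D.V i.succ

/-- `W_0`, the orthogonal complement of `a_1, …, a_k` in `V_0` (non-null case). -/
def W₀ : Submodule ℝ E :=
  D.V 0 ⊓ LinearMap.BilinForm.orthogonal g (Submodule.span ℝ (Set.range D.a))

/-- `b` is a lightlike vector of `V_0` with `⟨a_i, b⟩ = 1` (null case, where `i` is the only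
index). -/
def IsNullPartner (i : Fin k) (b : E) : Prop :=
  b ∈ D.V 0 ∧ b ≠ 0 ∧ g b b = 0 ∧ g (D.a i) b = 1

/-- `W_0`, the orthogonal complement of `span {a, b}` in `V_0` (null case). -/
def W₀Null (i : Fin k) (b : E) : Submodule ℝ E :=
  D.V 0 ⊓ LinearMap.BilinForm.orthogonal g (Submodule.span ℝ {D.a i, b})

end InitialData

end WarpedProduct

end

/-! The null and non-null cases are handled together by one choice of coordinates. A point of `N_i`
is `p̄ + u_i + s_i a_i` with `u_i ∈ V_i` and `u_i² + κ_i s_i² + 2 s_i = 0`; for `κ_i = 0` this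
equation gives the paraboloid, otherwise the hyperquadric with shifted center (`mem_N`). In
canonical form `ρ_i = ⟨a_i, p_0⟩`, so `ψ = p_0 + ∑ ρ_i (s_i a_i + u_i)`. Expanding the form
(`form_expand`), the quadric equation cancels every correction term, which gives `ψ² = p_0²`. The
same cancellation, with the linearised equation for tangent vectors, shows that `g` pulls back to
the warped metric (`form_fderiv_psi`).

The inverse is explicit. For `p = ψ(x)`, `⟨a_i, p⟩² + κ_i (p_{V_i})² = ρ_i²` (`radSq_psi`), so `p`
determines `ρ_i > 0` as a square root, then `u_i = p_{V_i} / ρ_i`, then `s_i`, from `⟨a_i, p⟩ = ρ_i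
(1 + κ_i s_i)` or, if `κ_i = 0`, from `s_i = -u_i²/2`, and finally `p_0`. These formulas are smooth
where the radicand is positive, and a null `a_i` needs the extra condition `⟨a_i, p⟩ > 0`; this open
set is the image (`image_eq_target`). The stated images and formulas follow by computing the
orthogonal projections. -/

namespace WarpedProduct

open Filter Topology
open scoped ContDiff

/-! ### Orthogonal projections -/

section

variable {E : Type*} [NormedAddCommGroup E] [NormedSpace ℝ E] {g : LinearMap.BilinForm ℝ E}

/-- A candidate projection `T` already forces `E = W ⊕ W^⊥`, so non-degeneracy of `W` need not be
checked separately. -/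
lemma orthProj_eq (hg : g.IsSymm) (hnd : g.Nondegenerate) {W : Submodule ℝ E} (T : E → E)
    (hT : ∀ p, T p ∈ W) (hT' : ∀ p, ∀ w ∈ W, g w (p - T p) = 0) (p : E) :
    orthProj g W p = T p := by
  have h : IsCompl W (LinearMap.BilinForm.orthogonal g W) := by
    constructor
    · rw [Submodule.disjoint_def]
      intro x hx hx'
      -- For `x ∈ W ∩ W^⊥`, `⟨x, y⟩ = ⟨x, T y⟩ = 0` for every `y`.
      refine hnd.1 x fun y => ?_
      have h1 : g (T y) x = 0 := hx' _ (hT y)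
      have h2 := hT' y x hx
      rw [map_sub, sub_eq_zero] at h2
      rw [h2, ← h1, ← hg.eq]
    · rw [codisjoint_iff, eq_top_iff]
      intro y _
      rw [← add_sub_cancel (T y) y]
      exact Submodule.add_mem_sup (hT y) (fun w hw => hT' y w hw)
  rw [orthProj, dif_pos h]
  conv_lhs => rw [← add_sub_cancel (T p) p]
  rw [map_add, (Submodule.projection_apply_eq_zero_iff h).2 (fun w hw => hT' p w hw), add_zero]
  exact congrArg Subtype.val (Submodule.projectionOnto_apply_left h ⟨T p, hT p⟩)

end

/-! ### Components of the decomposition and coordinates on the factors -/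

namespace InitialData

variable {E : Type*} [NormedAddCommGroup E] [NormedSpace ℝ E] {g : LinearMap.BilinForm ℝ E}
  {k : ℕ} (D : InitialData g k)

/-- The projection onto the summand `V i` of the decomposition. -/
noncomputable def proj (i : Fin (k + 1)) : E →ₗ[ℝ] E :=
  (D.V i).subtype ∘ₗ DirectSum.component ℝ (Fin (k + 1)) (fun j => D.V j) i ∘ₗ
    (LinearEquiv.ofBijective (DirectSum.coeLinearMap D.V) D.internal).symm.toLinearMap

lemma proj_mem (i : Fin (k + 1)) (x : E) : D.proj i x ∈ D.V i := Subtype.property _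

lemma proj_of_mem {i : Fin (k + 1)} {x : E} (hx : x ∈ D.V i) : D.proj i x = x :=
  congrArg Subtype.val (D.internal.ofBijective_coeLinearMap_of_mem hx)

lemma proj_of_mem_ne {i j : Fin (k + 1)} (hij : i ≠ j) {x : E} (hx : x ∈ D.V i) :
    D.proj j x = 0 :=
  congrArg Subtype.val (D.internal.ofBijective_coeLinearMap_of_mem_ne hij hx)

lemma sum_proj (x : E) : ∑ i, D.proj i x = x := by
  have h : ⨆ i, D.V i = ⊤ := D.internal.submodule_iSup_eq_top
  have hx : x ∈ ⨆ i, D.V i := h ▸ Submodule.mem_top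
  induction hx using Submodule.iSup_induction' with
  | mem i x hx =>
    rw [Finset.sum_eq_single i (fun j _ hj => D.proj_of_mem_ne hj.symm hx) (by simp),
      D.proj_of_mem hx]
  | zero => simp
  | add x y _ _ hx hy => simp [Finset.sum_add_distrib, hx, hy]

lemma proj_zero_add_sum (x : E) : D.proj 0 x + ∑ i : Fin k, D.proj i.succ x = x := by
  rw [← Fin.sum_univ_succ (fun i => D.proj i x), D.sum_proj]

lemma form_proj {i : Fin (k + 1)} {x : E} (hx : x ∈ D.V i) (y : E) :
    g x (D.proj i y) = g x y := by
  conv_rhs => rw [← D.sum_proj y, map_sum]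
  rw [Finset.sum_eq_single i]
  · intro j _ hj
    exact D.orthogonal i j hj.symm x hx _ (D.proj_mem j y)
  · simp

/-- A vector of `V_0` pairs only with the `V_0`-component, so `V_0` inherits non-degeneracy. -/
lemma exists_dual (hnd : g.Nondegenerate) {x : E} (hx : x ∈ D.V 0) (h : x ≠ 0) :
    ∃ b ∈ D.V 0, g x b = 1 := by
  by_contra! hb
  refine h (hnd.1 x fun y => ?_)
  by_contra hy
  refine hb ((g x y)⁻¹ • D.proj 0 y) (Submodule.smul_mem _ _ (D.proj_mem 0 y)) ?_
  rw [map_smul, D.form_proj hx, smul_eq_mul, inv_mul_cancel₀ hy]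

lemma form_zero_succ {x y : E} (hx : x ∈ D.V 0) {i : Fin k} (hy : y ∈ D.V i.succ) :
    g x y = 0 := D.orthogonal _ _ (Fin.succ_ne_zero i).symm x hx y hy

lemma form_succ_zero {x y : E} {i : Fin k} (hx : x ∈ D.V i.succ) (hy : y ∈ D.V 0) :
    g x y = 0 := D.orthogonal _ _ (Fin.succ_ne_zero i) x hx y hy

/-- Orthogonality removes every cross term between distinct indices. The vectors `x`, `y` keep their
pairings with `a_i`, because a null `a_i` cannot be split off orthogonally. -/
lemma form_expand (hg : g.IsSymm) {x y : E} (hx : x ∈ D.V 0) (hy : y ∈ D.V 0) (c d : Fin k → ℝ)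
    {u w : Fin k → E} (hu : ∀ i, u i ∈ D.V i.succ) (hw : ∀ i, w i ∈ D.V i.succ) :
    g (x + ∑ i, (c i • D.a i + u i)) (y + ∑ i, (d i • D.a i + w i)) =
      g x y + ∑ i, (d i * g (D.a i) x + c i * g (D.a i) y + D.kappa i * c i * d i
        + g (u i) (w i)) := by
  have h1 : ∀ i, g x (d i • D.a i + w i) = d i * g (D.a i) x := fun i => by
    rw [map_add, D.form_zero_succ hx (hw i), map_smul, hg.eq]; simp [hg.eq]
  have h2 : ∀ i, g (c i • D.a i + u i) y = c i * g (D.a i) y := fun i => by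
    simp [D.form_succ_zero (hu i) hy]
  have h3 : ∀ i j, g (c i • D.a i + u i) (d j • D.a j + w j) =
      if i = j then D.kappa i * c i * d i + g (u i) (w i) else 0 := fun i j => by
    have h4 := D.form_zero_succ (D.a_mem i) (hw j)
    have h5 := D.form_succ_zero (hu i) (D.a_mem j)
    split_ifs with hij
    · subst hij
      simp [h4, h5, kappa]; ring
    · simp [h4, h5, D.a_orthogonal i j hij,
        D.orthogonal _ _ ((Fin.succ_injective k).ne hij) _ (hu i) _ (hw j)]
  rw [map_add, map_add, LinearMap.add_apply, LinearMap.add_apply, map_sum, map_sum, map_sum,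
    LinearMap.sum_apply]
  simp only [LinearMap.sum_apply, h1, h2, h3, Finset.sum_ite_eq', Finset.mem_univ, if_true,
    Finset.sum_add_distrib]
  ring

/-- For `κ_i ≠ 0`, completing the square turns the equation into `v² + κ_i (s + 1/κ_i)² = 1/κ_i`;
for `κ_i = 0` it says `s = -v²/2`. -/
lemma mem_N {i : Fin k} (ha : D.a i ≠ 0) {x : E} :
    x ∈ D.N i ↔ ∃ v ∈ D.V i.succ, ∃ s : ℝ, g v v + D.kappa i * s ^ 2 + 2 * s = 0 ∧
      x = D.pt + (v + s • D.a i) := by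
  rw [N, sphericalSubmanifold, if_neg ha]
  split_ifs with h
  · have h' : D.kappa i = 0 := h
    constructor
    · rintro ⟨v, hv, rfl⟩
      refine ⟨v, hv, -(1 / 2 * g v v), by rw [h']; ring, ?_⟩
      module
    · rintro ⟨v, hv, s, hs, rfl⟩
      refine ⟨v, hv, ?_⟩
      rw [show s = -(1 / 2 * g v v) by rw [h'] at hs; linarith]
      module
  · have h' : D.kappa i ≠ 0 := h
    have key : ∀ v ∈ D.V i.succ, ∀ t : ℝ, g (t • D.a i + v) (t • D.a i + v) =
        t ^ 2 * D.kappa i + g v v := fun v hv t => by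
      simp [D.form_zero_succ (D.a_mem i) hv, D.form_succ_zero hv (D.a_mem i), kappa]; ring
    constructor
    · rintro ⟨q, hq, hqq, rfl⟩
      obtain ⟨y, hy, v, hv, rfl⟩ := Submodule.mem_sup.1 hq
      obtain ⟨t, rfl⟩ := Submodule.mem_span_singleton.1 hy
      rw [key v hv] at hqq
      change _ = 1 / D.kappa i at hqq
      -- The shift by `1/κ_i` moves the origin from the center `c_i` to `p̄`.
      refine ⟨v, hv, t - 1 / D.kappa i, ?_, ?_⟩
      · rw [show g v v = 1 / D.kappa i - t ^ 2 * D.kappa i by linarith]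
        field_simp; ring
      · change D.pt - (1 / D.kappa i) • D.a i + _ = _
        module
    · rintro ⟨v, hv, s, hs, rfl⟩
      refine ⟨(s + 1 / D.kappa i) • D.a i + v, Submodule.add_mem_sup
        (Submodule.smul_mem _ _ (Submodule.mem_span_singleton_self _)) hv, ?_, ?_⟩
      · rw [key v hv]
        change _ = 1 / D.kappa i
        rw [show g v v = - D.kappa i * s ^ 2 - 2 * s by linarith]
        field_simp; ring
      · change _ = D.pt - (1 / D.kappa i) • D.a i + _
        module

lemma rho_eq (hg : g.IsSymm) (hcan : D.IsCanonical) (i : Fin k) (p : E) :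
    D.rho i p = g (D.a i) p := by
  rw [rho, map_sub, ← hg.eq D.pt]
  simp [hcan.2 i]

lemma N₀_eq (hg : g.IsSymm) (hcan : D.IsCanonical) :
    D.N₀ = {p | p ∈ D.V 0 ∧ ∀ i, 0 < g (D.a i) p} := by
  ext p
  simp only [N₀, sphericalSubmanifold, if_true, Set.mem_ofPred_eq, D.rho_eq hg hcan]
  refine and_congr_left fun _ => ⟨?_, fun hp => ⟨p - D.pt, sub_mem hp hcan.1, by simp⟩⟩
  rintro ⟨v, hv, rfl⟩
  exact add_mem hcan.1 hv

/-- Points of the product in coordinates adapted to the decomposition. -/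
lemma exists_of_mem_domain (hg : g.IsSymm) (hcan : D.IsCanonical) (ha : ∀ i, D.a i ≠ 0)
    {x : E × (Fin k → E)} (hx : x ∈ D.domain) :
    x.1 ∈ D.V 0 ∧ (∀ i, 0 < g (D.a i) x.1) ∧ ∃ (u : Fin k → E) (s : Fin k → ℝ),
      (∀ i, u i ∈ D.V i.succ) ∧ (∀ i, g (u i) (u i) + D.kappa i * s i ^ 2 + 2 * s i = 0) ∧
      (∀ i, x.2 i = D.pt + (u i + s i • D.a i)) ∧
      D.psi x = x.1 + ∑ i, ((g (D.a i) x.1 * s i) • D.a i + g (D.a i) x.1 • u i) := by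
  obtain ⟨h0, h1⟩ := hx
  rw [D.N₀_eq hg hcan] at h0
  choose u hu s hs hx using fun i => (D.mem_N (ha i)).1 (h1 i)
  refine ⟨h0.1, h0.2, u, s, hu, hs, hx, ?_⟩
  rw [psi]
  congr 1
  refine Finset.sum_congr rfl fun i _ => ?_
  rw [hx i, D.rho_eq hg hcan]
  module

lemma proj_zero_expand {x : E} (hx : x ∈ D.V 0) (c : Fin k → ℝ) {u : Fin k → E}
    (hu : ∀ i, u i ∈ D.V i.succ) :
    D.proj 0 (x + ∑ i, (c i • D.a i + u i)) = x + ∑ i, c i • D.a i := by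
  simp [D.proj_of_mem hx, D.proj_of_mem (D.a_mem _),
    D.proj_of_mem_ne (Fin.succ_ne_zero _) (hu _)]

lemma proj_succ_expand {x : E} (hx : x ∈ D.V 0) (c : Fin k → ℝ) {u : Fin k → E}
    (hu : ∀ i, u i ∈ D.V i.succ) (j : Fin k) :
    D.proj j.succ (x + ∑ i, (c i • D.a i + u i)) = u j := by
  have h : ∀ i, D.proj j.succ (u i) = if i = j then u j else 0 := fun i => by
    split_ifs with hij
    · subst hij; exact D.proj_of_mem (hu _)
    · exact D.proj_of_mem_ne ((Fin.succ_injective k).ne hij) (hu i)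
  simp [D.proj_of_mem_ne (Fin.succ_ne_zero _).symm hx,
    D.proj_of_mem_ne (Fin.succ_ne_zero _).symm (D.a_mem _), h]

lemma form_a_expand (x : E) (c : Fin k → ℝ) {u : Fin k → E}
    (hu : ∀ i, u i ∈ D.V i.succ) (j : Fin k) :
    g (D.a j) (x + ∑ i, (c i • D.a i + u i)) = g (D.a j) x + D.kappa j * c j := by
  have h : ∀ i, g (D.a j) (D.a i) = if i = j then D.kappa j else 0 := fun i => by
    split_ifs with hij
    · subst hij; rfl
    · exact D.a_orthogonal _ _ (Ne.symm hij)
  simp [D.form_zero_succ (D.a_mem _) (hu _), h, mul_comm]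

lemma psi_sq (hg : g.IsSymm) (hcan : D.IsCanonical) (ha : ∀ i, D.a i ≠ 0)
    {x : E × (Fin k → E)} (hx : x ∈ D.domain) : g (D.psi x) (D.psi x) = g x.1 x.1 := by
  obtain ⟨h0, -, u, s, hu, hs, -, hpsi⟩ := D.exists_of_mem_domain hg hcan ha hx
  have hu' : ∀ i, g (D.a i) x.1 • u i ∈ D.V i.succ := fun i => Submodule.smul_mem _ _ (hu i)
  rw [hpsi, D.form_expand hg h0 h0 _ _ hu' hu', add_eq_left]
  refine Finset.sum_eq_zero fun i _ => ?_
  simp only [map_smul, LinearMap.smul_apply, smul_eq_mul]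
  linear_combination g (D.a i) x.1 ^ 2 * hs i

end InitialData

/-! ### Tangent vectors and the pulled-back metric -/

lemma IsTangentVector.apply_eq_zero {F G : Type*} [NormedAddCommGroup F] [NormedSpace ℝ F]
    [NormedAddCommGroup G] [NormedSpace ℝ G]
    {S : Set F} {x v : F} (h : IsTangentVector S x v) (q : F → G) (q' : F →L[ℝ] G)
    (hq : HasFDerivAt q q' x) (h0 : ∀ y ∈ S, q y = 0) : q' v = 0 := by
  obtain ⟨γ, -, rfl, hS, hd⟩ := h
  have h1 : HasDerivAt (q ∘ γ) (q' v) 0 := hq.comp_hasDerivAt 0 hd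
  have h2 : q ∘ γ =ᶠ[𝓝 0] fun _ => 0 := hS.mono fun t ht => h0 _ ht
  exact h1.unique ((hasDerivAt_const (0 : ℝ) (0 : G)).congr_of_eventuallyEq h2)

namespace InitialData

section Tangent

variable {E : Type*} [NormedAddCommGroup E] [NormedSpace ℝ E] [FiniteDimensional ℝ E]
  {g : LinearMap.BilinForm ℝ E} {k : ℕ} (D : InitialData g k)

/-- The coordinates of tangent vectors to the product. -/
lemma exists_of_isTangentVector (hg : g.IsSymm) (hnd : g.Nondegenerate) (hcan : D.IsCanonical)
    (ha : ∀ i, D.a i ≠ 0) {x v : E × (Fin k → E)} (hv : IsTangentVector D.domain x v)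
    {u : Fin k → E} {s : Fin k → ℝ} (hu : ∀ i, u i ∈ D.V i.succ)
    (hxu : ∀ i, x.2 i = D.pt + (u i + s i • D.a i)) :
    v.1 ∈ D.V 0 ∧ ∃ (w : Fin k → E) (σ : Fin k → ℝ), (∀ i, w i ∈ D.V i.succ) ∧
      (∀ i, v.2 i = w i + σ i • D.a i) ∧
      ∀ i, g (u i) (w i) + D.kappa i * s i * σ i + σ i = 0 := by
  -- `⟨b_i, ·⟩` reads off the coefficient of `a_i`, since `b_i ∈ V_0` is orthogonal to `V_i`;
  -- pairing with `a_i` would fail for null `a_i`.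
  choose b hb hab using fun i => D.exists_dual hnd (D.a_mem i) (ha i)
  let pr (j : Fin (k + 1)) : E →L[ℝ] E := (D.proj j).toContinuousLinearMap
  let B : E →L[ℝ] E →L[ℝ] ℝ := LinearMap.toContinuousBilinearMap g
  let π₂ (i : Fin k) : E × (Fin k → E) →L[ℝ] E :=
    (ContinuousLinearMap.proj i).comp (ContinuousLinearMap.snd ℝ E (Fin k → E))
  have hba : ∀ i, g (b i) (D.a i) = 1 := fun i => by rw [← hab i, ← hg.eq]
  have hbV : ∀ i, ∀ w ∈ D.V i.succ, g (b i) w = 0 := fun i w hw => D.form_zero_succ (hb i) hw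
  have h1 : v.1 - D.proj 0 v.1 = 0 := by
    let L : E × (Fin k → E) →L[ℝ] E :=
      (ContinuousLinearMap.id ℝ E - pr 0).comp (ContinuousLinearMap.fst ℝ E (Fin k → E))
    refine hv.apply_eq_zero L L L.hasFDerivAt fun y hy => ?_
    change y.1 - D.proj 0 y.1 = 0
    rw [D.proj_of_mem (D.exists_of_mem_domain hg hcan ha hy).1, sub_self]
  have h2 : ∀ i, v.2 i - (D.proj i.succ (v.2 i) + g (b i) (v.2 i) • D.a i) = 0 := fun i => by
    let L : E →L[ℝ] E := ContinuousLinearMap.id ℝ E - (pr i.succ + (B (b i)).smulRight (D.a i))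
    have hL : ∀ y, L y = y - (D.proj i.succ y + g (b i) y • D.a i) := fun y => rfl
    have hd : HasFDerivAt (fun y : E × (Fin k → E) => L (y.2 i - D.pt)) (L.comp (π₂ i)) x :=
      L.hasFDerivAt.comp x ((π₂ i).hasFDerivAt.sub_const D.pt)
    refine hv.apply_eq_zero _ _ hd fun y hy => ?_
    obtain ⟨w, hw, t, -, hy'⟩ := (D.mem_N (ha i)).1 (hy.2 i)
    rw [hy', add_sub_cancel_left, hL]
    simp [D.proj_of_mem hw, D.proj_of_mem_ne (Fin.succ_ne_zero i).symm (D.a_mem i), hbV i w hw,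
      hba]
  -- This is the derivative of the quadric equation, written as `y² + 2⟨b_i, y⟩ = 0` with `y = x_i -
  -- p̄`.
  have h3 : ∀ i, g (x.2 i - D.pt) (v.2 i) + g (v.2 i) (x.2 i - D.pt)
      + 2 * g (b i) (v.2 i) = 0 := fun i => by
    have hr : HasFDerivAt (fun y : E × (Fin k → E) => y.2 i - D.pt) (π₂ i) x :=
      (π₂ i).hasFDerivAt.sub_const D.pt
    have hd := (B.hasFDerivAt_of_bilinear hr hr).add
      (((B (b i)).hasFDerivAt.comp x hr).const_mul 2)
    refine hv.apply_eq_zero _ _ hd fun y hy => ?_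
    obtain ⟨w, hw, t, ht, hy'⟩ := (D.mem_N (ha i)).1 (hy.2 i)
    change g (y.2 i - D.pt) (y.2 i - D.pt) + 2 * g (b i) (y.2 i - D.pt) = 0
    rw [hy', add_sub_cancel_left]
    rw [kappa] at ht
    simp [hbV i w hw, hba, D.form_zero_succ (D.a_mem i) hw, D.form_succ_zero hw (D.a_mem i)]
    linear_combination ht
  have hw : ∀ i, D.proj i.succ (v.2 i) ∈ D.V i.succ := fun i => D.proj_mem _ _
  refine ⟨(sub_eq_zero.1 h1) ▸ D.proj_mem 0 v.1, fun i => D.proj i.succ (v.2 i),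
    fun i => g (b i) (v.2 i), hw, fun i => sub_eq_zero.1 (h2 i), fun i => ?_⟩
  have h4 := h3 i
  have h5 : g (v.2 i) (x.2 i - D.pt) = g (x.2 i - D.pt) (v.2 i) := by
    rw [← hg.eq]
  rw [h5, hxu i, add_sub_cancel_left] at h4
  have h6 : g (u i + s i • D.a i) (v.2 i) =
      g (u i) (D.proj i.succ (v.2 i)) + D.kappa i * s i * g (b i) (v.2 i) := by
    conv_lhs => rw [sub_eq_zero.1 (h2 i)]
    simp [D.form_zero_succ (D.a_mem i) (hw i), D.form_succ_zero (hu i) (D.a_mem i), kappa]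
    ring
  linear_combination h4 / 2 - h6

lemma contDiff_psi : ContDiff ℝ ∞ D.psi := by
  have h : ∀ i, ContDiff ℝ ∞ fun x : E => g (D.a i) x := fun i =>
    (g (D.a i)).toContinuousLinearMap.contDiff
  unfold psi rho
  have h' : ∀ i, ContDiff ℝ ∞ fun x : E × (Fin k → E) => g (D.a i) (x.1 - D.pt) := fun i =>
    (h i).comp (contDiff_fst.sub contDiff_const)
  fun_prop

lemma fderiv_psi (x v : E × (Fin k → E)) : fderiv ℝ D.psi x v =
    v.1 + ∑ i, (D.rho i x.1 • v.2 i + g (D.a i) v.1 • (x.2 i - D.pt)) := by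
  let A (i : Fin k) : E →L[ℝ] ℝ := (g (D.a i)).toContinuousLinearMap
  let π₁ := ContinuousLinearMap.fst ℝ E (Fin k → E)
  let π₂ (i : Fin k) : E × (Fin k → E) →L[ℝ] E :=
    (ContinuousLinearMap.proj i).comp (ContinuousLinearMap.snd ℝ E (Fin k → E))
  have hr : ∀ i, HasFDerivAt (fun y : E × (Fin k → E) => D.rho i y.1) ((A i).comp π₁) x :=
    fun i => ((A i).hasFDerivAt.comp x (π₁.hasFDerivAt.sub_const D.pt)).const_add 1
  have hd : HasFDerivAt D.psi (π₁ + ∑ i, (D.rho i x.1 • π₂ i +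
      ((A i).comp π₁).smulRight (x.2 i - D.pt))) x :=
    π₁.hasFDerivAt.add (HasFDerivAt.fun_sum fun i _ =>
      (hr i).smul ((π₂ i).hasFDerivAt.sub_const D.pt))
  rw [hd.fderiv]
  simp [π₁, π₂, A]

lemma form_fderiv_psi (hg : g.IsSymm) (hnd : g.Nondegenerate) (hcan : D.IsCanonical)
    (ha : ∀ i, D.a i ≠ 0) {x v w : E × (Fin k → E)} (hx : x ∈ D.domain)
    (hv : IsTangentVector D.domain x v) (hw : IsTangentVector D.domain x w) :
    g (fderiv ℝ D.psi x v) (fderiv ℝ D.psi x w) = D.warpedMetric x v w := by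
  obtain ⟨h0, -, u, s, hu, hs, hxu, -⟩ := D.exists_of_mem_domain hg hcan ha hx
  obtain ⟨hv0, m, σ, hm, hvm, hσ⟩ := D.exists_of_isTangentVector hg hnd hcan ha hv hu hxu
  obtain ⟨hw0, n, τ, hn, hwn, hτ⟩ := D.exists_of_isTangentVector hg hnd hcan ha hw hu hxu
  have key : ∀ {v : E × (Fin k → E)} {m : Fin k → E} {σ : Fin k → ℝ},
      (∀ i, v.2 i = m i + σ i • D.a i) → fderiv ℝ D.psi x v = v.1 + ∑ i,
        ((g (D.a i) v.1 * s i + D.rho i x.1 * σ i) • D.a i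
          + (g (D.a i) v.1 • u i + D.rho i x.1 • m i)) := by
    intro v m σ h
    rw [fderiv_psi]
    congr 1
    refine Finset.sum_congr rfl fun i _ => ?_
    rw [h i, hxu i]
    module
  have hmem : ∀ (c : Fin k → ℝ) {m : Fin k → E}, (∀ i, m i ∈ D.V i.succ) →
      ∀ i, c i • u i + D.rho i x.1 • m i ∈ D.V i.succ := fun c m hm i =>
    add_mem (Submodule.smul_mem _ _ (hu i)) (Submodule.smul_mem _ _ (hm i))
  rw [key hvm, key hwn, D.form_expand hg hv0 hw0 _ _ (hmem _ hm) (hmem _ hn), warpedMetric]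
  congr 1
  refine Finset.sum_congr rfl fun i _ => ?_
  have h1 : g (m i) (u i) = g (u i) (m i) := by rw [← hg.eq]
  rw [hvm, hwn]
  simp only [map_add, map_smul, LinearMap.add_apply, LinearMap.smul_apply, smul_eq_mul, h1,
    D.form_zero_succ (D.a_mem i) (hn i), D.form_succ_zero (hm i) (D.a_mem i)]
  rw [← kappa]
  -- With `α = ⟨a_i, v_0⟩` and `β = ⟨a_i, w_0⟩`, the coefficient of `αβ` is the quadric equation and
  -- those of `ρβ`, `ρα` are its linearisations at `v` and `w`; only the `ρ²` term survives.
  linear_combination g (D.a i) v.1 * g (D.a i) w.1 * hs i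
    + D.rho i x.1 * g (D.a i) w.1 * hσ i + D.rho i x.1 * g (D.a i) v.1 * hτ i

end Tangent

end InitialData

/-! ### The explicit inverse of `ψ` and its image -/

namespace InitialData

variable {E : Type*} [NormedAddCommGroup E] [NormedSpace ℝ E]
  {g : LinearMap.BilinForm ℝ E} {k : ℕ} (D : InitialData g k)

/-- The square of the warping function `ρ_i`, as a function on the image of `ψ`. -/
noncomputable def radSq (i : Fin k) (p : E) : ℝ :=
  g (D.a i) p ^ 2 + D.kappa i * g (D.proj i.succ p) (D.proj i.succ p)

/-- The set onto which `ψ` maps, described uniformly in all cases. -/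
def target : Set E := {p | ∀ i, 0 < D.radSq i p ∧ (D.kappa i = 0 → 0 < g (D.a i) p)}

/-- The component along `a_i` of the spherical factor of the inverse of `ψ`. -/
noncomputable def axial (i : Fin k) (p : E) : ℝ :=
  open Classical in
  if D.kappa i = 0 then -(g (D.proj i.succ p) (D.proj i.succ p) / (2 * D.radSq i p))
  else (g (D.a i) p / √(D.radSq i p) - 1) / D.kappa i

/-- The inverse of `ψ`. -/
noncomputable def psiInv (p : E) : E × (Fin k → E) :=
  (D.proj 0 p - ∑ i, (√(D.radSq i p) * D.axial i p) • D.a i,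
    fun i => D.pt + ((√(D.radSq i p))⁻¹ • D.proj i.succ p + D.axial i p • D.a i))

lemma contDiffOn_psiInv [FiniteDimensional ℝ E] : ContDiffOn ℝ ∞ D.psiInv D.target := by
  have hpr : ∀ i, ContDiff ℝ ∞ (D.proj i) := fun i => (D.proj i).toContinuousLinearMap.contDiff
  have hA : ∀ i, ContDiff ℝ ∞ fun p => g (D.a i) p := fun i =>
    (g (D.a i)).toContinuousLinearMap.contDiff
  have hQ : ∀ i : Fin k, ContDiff ℝ ∞ fun p => g (D.proj i.succ p) (D.proj i.succ p) := fun i =>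
    ((LinearMap.toContinuousBilinearMap g).contDiff.comp (hpr i.succ)).clm_apply (hpr i.succ)
  have hR : ∀ i : Fin k, ContDiff ℝ ∞ (D.radSq i) := fun i =>
    ((hA i).pow 2).add (contDiff_const.mul (hQ i))
  have hne : ∀ i, ∀ p ∈ D.target, D.radSq i p ≠ 0 := fun i p hp => (hp i).1.ne'
  have hS : ∀ i : Fin k, ContDiffOn ℝ ∞ (fun p => √(D.radSq i p)) D.target := fun i =>
    (hR i).contDiffOn.sqrt (hne i)
  have hSne : ∀ i, ∀ p ∈ D.target, √(D.radSq i p) ≠ 0 := fun i p hp =>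
    (Real.sqrt_pos.2 (hp i).1).ne'
  have hX : ∀ i : Fin k, ContDiffOn ℝ ∞ (D.axial i) D.target := fun i => by
    by_cases h : D.kappa i = 0
    · have : D.axial i =
          fun p => -(g (D.proj i.succ p) (D.proj i.succ p) / (2 * D.radSq i p)) := by
        funext p; rw [axial, if_pos h]
      rw [this]
      exact ((hQ i).contDiffOn.div (contDiffOn_const.mul (hR i).contDiffOn)
        fun p hp => mul_ne_zero two_ne_zero (hne i p hp)).neg
    · have : D.axial i = fun p => (g (D.a i) p / √(D.radSq i p) - 1) / D.kappa i := by
        funext p; rw [axial, if_neg h]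
      rw [this]
      exact (((hA i).contDiffOn.div (hS i) (hSne i)).sub contDiffOn_const).div_const _
  refine ContDiffOn.prodMk ((hpr 0).contDiffOn.sub (ContDiffOn.sum fun i _ =>
    ((hS i).mul (hX i)).smul contDiffOn_const)) (contDiffOn_pi.2 fun i =>
    contDiffOn_const.add ((((hS i).inv (hSne i)).smul (hpr i.succ).contDiffOn).add
      ((hX i).smul contDiffOn_const)))

lemma isOpen_target [FiniteDimensional ℝ E] : IsOpen D.target := by
  have hA : ∀ i, Continuous fun p => g (D.a i) p := fun i =>
    (g (D.a i)).toContinuousLinearMap.continuous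
  have hpr : ∀ i, Continuous (D.proj i) := fun i => (D.proj i).toContinuousLinearMap.continuous
  have hR : ∀ i : Fin k, Continuous (D.radSq i) := fun i =>
    ((hA i).pow 2).add (continuous_const.mul
      (((LinearMap.toContinuousBilinearMap g).continuous.comp (hpr i.succ)).clm_apply (hpr i.succ)))
  rw [target, Set.ofPred_forall]
  refine isOpen_iInter_of_finite fun i => (isOpen_lt continuous_const (hR i)).inter ?_
  change IsOpen {p | D.kappa i = 0 → 0 < g (D.a i) p}
  -- The premise does not depend on `p`, so the set is an open half-space or everything.
  by_cases h : D.kappa i = 0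
  · simpa only [h, true_imp_iff] using isOpen_lt continuous_const (hA i)
  · simp [h]

section

variable (hg : g.IsSymm) (hcan : D.IsCanonical) (ha : ∀ i, D.a i ≠ 0)
include hg hcan ha

/-- Since `⟨a_i, ψ⟩ = ρ_i (1 + κ_i s_i)` and the `V_i`-component is `ρ_i u_i`, the claim is `(1 +
κ_i s_i)² + κ_i u_i² = 1`, which is `κ_i` times the quadric equation. -/
lemma radSq_psi {x : E × (Fin k → E)} (hx : x ∈ D.domain) (i : Fin k) :
    D.radSq i (D.psi x) = g (D.a i) x.1 ^ 2 := by
  obtain ⟨h0, -, u, s, hu, hs, -, hpsi⟩ := D.exists_of_mem_domain hg hcan ha hx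
  have hu' : ∀ i, g (D.a i) x.1 • u i ∈ D.V i.succ := fun i => Submodule.smul_mem _ _ (hu i)
  rw [radSq, hpsi, D.form_a_expand _ _ hu', D.proj_succ_expand h0 _ hu']
  simp only [map_smul, LinearMap.smul_apply, smul_eq_mul]
  linear_combination D.kappa i * g (D.a i) x.1 ^ 2 * hs i

lemma mapsTo_psi : Set.MapsTo D.psi D.domain D.target := by
  intro x hx i
  rw [D.radSq_psi hg hcan ha hx]
  obtain ⟨h0, hpos, u, s, hu, hs, -, hpsi⟩ := D.exists_of_mem_domain hg hcan ha hx
  have hu' : ∀ i, g (D.a i) x.1 • u i ∈ D.V i.succ := fun i => Submodule.smul_mem _ _ (hu i)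
  refine ⟨pow_pos (hpos i) 2, fun h => ?_⟩
  rw [hpsi, D.form_a_expand _ _ hu', h, zero_mul, add_zero]
  exact hpos i

lemma leftInvOn_psiInv : Set.LeftInvOn D.psiInv D.psi D.domain := by
  intro x hx
  obtain ⟨h0, hpos, u, s, hu, hs, hxu, hpsi⟩ := D.exists_of_mem_domain hg hcan ha hx
  have hu' : ∀ i, g (D.a i) x.1 • u i ∈ D.V i.succ := fun i => Submodule.smul_mem _ _ (hu i)
  have hrad := D.radSq_psi hg hcan ha hx
  have hsqrt : ∀ i, √(D.radSq i (D.psi x)) = g (D.a i) x.1 := fun i => by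
    rw [hrad, Real.sqrt_sq (hpos i).le]
  have hz : ∀ i, D.proj i.succ (D.psi x) = g (D.a i) x.1 • u i := fun i => by
    rw [hpsi, D.proj_succ_expand h0 _ hu']
  have hs' : ∀ i, D.axial i (D.psi x) = s i := fun i => by
    have hne := (hpos i).ne'
    rw [axial, hsqrt, hz, hrad]
    split_ifs with h
    · have h1 := hs i
      rw [h] at h1
      simp only [map_smul, LinearMap.smul_apply, smul_eq_mul]
      rw [show g (u i) (u i) = -2 * s i by linarith]
      field_simp
    · rw [hpsi, D.form_a_expand _ _ hu']
      field_simp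
      ring
  refine Prod.ext ?_ (funext fun i => ?_)
  · simp only [psiInv, hsqrt, hs']
    rw [hpsi, D.proj_zero_expand h0 _ hu', add_sub_cancel_right]
  · simp only [psiInv, hsqrt, hs', hz]
    rw [inv_smul_smul₀ (hpos i).ne', hxu i]

omit hg hcan ha in
-- The first equation puts the reconstructed point on `N_i`; the second makes `⟨a_i, p_0⟩` equal to
-- the square root, so that `ρ_i` is recovered.
lemma axial_spec {p : E} (hp : p ∈ D.target) (i : Fin k) :
    g ((√(D.radSq i p))⁻¹ • D.proj i.succ p) ((√(D.radSq i p))⁻¹ • D.proj i.succ p) +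
      D.kappa i * D.axial i p ^ 2 + 2 * D.axial i p = 0 ∧
    g (D.a i) p - D.kappa i * (√(D.radSq i p) * D.axial i p) = √(D.radSq i p) := by
  have hr : 0 < √(D.radSq i p) := Real.sqrt_pos.2 (hp i).1
  have hsq : √(D.radSq i p) ^ 2 = D.radSq i p := Real.sq_sqrt (hp i).1.le
  have hrad : √(D.radSq i p) ^ 2 = g (D.a i) p ^ 2 +
    D.kappa i * g (D.proj i.succ p) (D.proj i.succ p) := hsq
  simp only [map_smul, LinearMap.smul_apply, smul_eq_mul]
  have hpos := (hp i).2
  rw [axial]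
  generalize √(D.radSq i p) = r at *
  split_ifs with h
  · rw [← hsq]
    rw [h] at hrad ⊢
    constructor
    · field_simp
      ring
    -- Here `r² = ⟨a_i, p⟩²`; the sign condition of `target` excludes `r = -⟨a_i, p⟩`.
    · have h1 := hpos h
      have h2 : r = g (D.a i) p :=
        (pow_left_inj₀ hr.le h1.le two_ne_zero).1 (by linarith)
      rw [h2]; ring
  · constructor
    · rw [show g (D.proj i.succ p) (D.proj i.succ p) = (r ^ 2 - g (D.a i) p ^ 2) / D.kappa i by
        rw [hrad]; field_simp; ring]
      field_simp
      ring
    · field_simp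
      ring

omit hg hcan ha in
lemma form_a_psiInv {p : E} (hp : p ∈ D.target) (i : Fin k) :
    g (D.a i) (D.psiInv p).1 = √(D.radSq i p) := by
  have h := D.form_a_expand (D.proj 0 p) (fun i => -(√(D.radSq i p) * D.axial i p))
    (u := fun _ => 0) (fun _ => zero_mem _) i
  rw [psiInv, ← (D.axial_spec hp i).2, ← D.form_proj (D.a_mem i) p]
  simp only [neg_smul, add_zero, Finset.sum_neg_distrib] at h
  rw [sub_eq_add_neg, h]
  ring

lemma mapsTo_psiInv : Set.MapsTo D.psiInv D.target D.domain := by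
  intro p hp
  constructor
  · rw [D.N₀_eq hg hcan]
    refine ⟨sub_mem (D.proj_mem 0 p) (sum_mem fun i _ => Submodule.smul_mem _ _ (D.a_mem i)),
      fun i => ?_⟩
    rw [D.form_a_psiInv hp]
    exact Real.sqrt_pos.2 (hp i).1
  · exact fun i => (D.mem_N (ha i)).2 ⟨_, Submodule.smul_mem _ _ (D.proj_mem _ _), _,
      (D.axial_spec hp i).1, rfl⟩

omit ha in
lemma rightInvOn_psiInv : Set.RightInvOn D.psiInv D.psi D.target := by
  intro p hp
  have h : ∀ i, D.rho i (D.psiInv p).1 • ((D.psiInv p).2 i - D.pt) =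
      D.proj i.succ p + (√(D.radSq i p) * D.axial i p) • D.a i := fun i => by
    rw [D.rho_eq hg hcan, D.form_a_psiInv hp, psiInv, add_sub_cancel_left, smul_add,
      smul_inv_smul₀ (Real.sqrt_pos.2 (hp i).1).ne', smul_smul]
  rw [psi]
  simp only [h, Finset.sum_add_distrib]
  conv_rhs => rw [← D.proj_zero_add_sum p]
  exact sub_add_add_cancel _ _ _

lemma bijOn_psi : Set.BijOn D.psi D.domain D.target :=
  Set.InvOn.bijOn ⟨D.leftInvOn_psiInv hg hcan ha, D.rightInvOn_psiInv hg hcan⟩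
    (D.mapsTo_psi hg hcan ha) (D.mapsTo_psiInv hg hcan ha)

lemma image_eq_target : D.image = D.target := (D.bijOn_psi hg hcan ha).image_eq

lemma image_nonempty : D.image.Nonempty := by
  -- The base point lies in every factor, with `u_i = 0` and `s_i = 0`.
  refine ⟨_, (D.pt, fun _ => D.pt), ⟨?_, fun i => ?_⟩, rfl⟩
  · rw [D.N₀_eq hg hcan]
    refine ⟨hcan.1, fun i => ?_⟩
    rw [← hg.eq, hcan.2 i]
    exact one_pos
  · exact (D.mem_N (ha i)).2 ⟨0, zero_mem _, 0, by simp, by simp⟩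

end

/-! ### Non-null case: projections, image and formula for `ψ` -/

section NonNull

lemma orthProj_V (hg : g.IsSymm) (hnd : g.Nondegenerate) (i : Fin (k + 1)) (p : E) :
    orthProj g (D.V i) p = D.proj i p :=
  orthProj_eq hg hnd (D.proj i) (D.proj_mem i) (fun q w hw => by
    rw [map_sub, D.form_proj hw, sub_self]) p

lemma orthProj_W (hg : g.IsSymm) (hnd : g.Nondegenerate) {i : Fin k} (h : D.kappa i ≠ 0) (p : E) :
    orthProj g (D.W i) p = (g (D.a i) p / D.kappa i) • D.a i + D.proj i.succ p := by
  refine orthProj_eq hg hnd (fun p => (g (D.a i) p / D.kappa i) • D.a i + D.proj i.succ p)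
    (fun p => Submodule.add_mem_sup (Submodule.smul_mem _ _ (Submodule.mem_span_singleton_self _))
      (D.proj_mem _ _)) (fun q w hw => ?_) p
  obtain ⟨y, hy, v, hv, rfl⟩ := Submodule.mem_sup.1 hw
  obtain ⟨t, rfl⟩ := Submodule.mem_span_singleton.1 hy
  have h1 : g (D.a i) (D.a i) = D.kappa i := rfl
  simp only [map_sub, map_add, map_smul, LinearMap.add_apply, LinearMap.smul_apply, smul_eq_mul,
    D.form_proj hv, D.form_zero_succ (D.a_mem i) (D.proj_mem i.succ q),
    D.form_succ_zero hv (D.a_mem i), h1]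
  field_simp
  ring

lemma orthProj_W₀ (hg : g.IsSymm) (hnd : g.Nondegenerate) (h : D.IsNonNull) (p : E) :
    orthProj g D.W₀ p = D.proj 0 p - ∑ i, (g (D.a i) p / D.kappa i) • D.a i := by
  refine orthProj_eq hg hnd (fun p => D.proj 0 p - ∑ i, (g (D.a i) p / D.kappa i) • D.a i)
    (fun p => Submodule.mem_inf.2
      ⟨sub_mem (D.proj_mem 0 p) (sum_mem fun i _ => Submodule.smul_mem _ _ (D.a_mem i)), ?_⟩)
    (fun q w hw => ?_) p
  · rw [LinearMap.BilinForm.mem_orthogonal_iff]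
    intro y hy
    change g y _ = 0
    induction hy using Submodule.span_induction with
    | zero => simp
    | add y z _ _ hy hz => rw [map_add, LinearMap.add_apply, hy, hz, add_zero]
    | smul c y _ hy => rw [map_smul, LinearMap.smul_apply, hy, smul_zero]
    | mem y hy =>
      obtain ⟨i, rfl⟩ := hy
      have h' := D.form_a_expand (D.proj 0 p) (fun i => -(g (D.a i) p / D.kappa i))
        (u := fun _ => 0) (fun _ => zero_mem _) i
      simp only [neg_smul, add_zero, Finset.sum_neg_distrib] at h'
      rw [sub_eq_add_neg, h', D.form_proj (D.a_mem i)]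
      have := h i
      field_simp
      ring
  · have h' : ∀ i, g w (D.a i) = 0 := fun i => by
      rw [← hg.eq]
      exact hw.2 _ (Submodule.subset_span (Set.mem_range_self i))
    simp [D.form_proj hw.1, h']

/-- The radicand equals `κ_i (P_i p)²`, so its positivity means that the two factors have the same
sign. -/
lemma target_of_nonNull (hg : g.IsSymm) (hnd : g.Nondegenerate) (h : D.IsNonNull) :
    D.target = {p | ∀ i, SignType.sign (g (orthProj g (D.W i) p) (orthProj g (D.W i) p)) =
      SignType.sign (D.kappa i)} := by
  ext p
  refine forall_congr' fun i => ?_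
  have hi := h i
  have h1 : g (D.a i) (D.a i) = D.kappa i := rfl
  have key : D.radSq i p = g (orthProj g (D.W i) p) (orthProj g (D.W i) p) * D.kappa i := by
    rw [D.orthProj_W hg hnd hi, radSq]
    simp only [map_add, map_smul, LinearMap.add_apply, LinearMap.smul_apply, smul_eq_mul, h1,
      D.form_zero_succ (D.a_mem i) (D.proj_mem i.succ p),
      D.form_succ_zero (D.proj_mem i.succ p) (D.a_mem i)]
    field_simp
    ring
  simp only [hi, false_imp_iff, and_true, key]
  generalize g (orthProj g (D.W i) p) (orthProj g (D.W i) p) = r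
  rcases lt_or_gt_of_ne hi with h | h
  · rw [sign_neg h, sign_eq_neg_one_iff, ← neg_mul_neg, mul_pos_iff_of_pos_right (neg_pos.2 h),
      Left.neg_pos_iff]
  · rw [sign_pos h, sign_eq_one_iff, mul_pos_iff_of_pos_right h]

/-- The terms `ρ_i a_i / κ_i` move from `p_0` to the spherical factors, leaving `P_0 p_0` and
changing `p̄` into `c_i`. -/
lemma psi_of_nonNull (hg : g.IsSymm) (hnd : g.Nondegenerate) (hcan : D.IsCanonical)
    (h : D.IsNonNull) {x : E × (Fin k → E)} (hx : x.1 ∈ D.V 0) :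
    D.psi x = orthProj g D.W₀ x.1 + ∑ i, g (D.a i) x.1 • (x.2 i - D.c i) := by
  rw [D.orthProj_W₀ hg hnd h, D.proj_of_mem hx, psi, sub_add, ← Finset.sum_sub_distrib,
    sub_eq_add_neg, ← Finset.sum_neg_distrib]
  congr 1
  refine Finset.sum_congr rfl fun i _ => ?_
  rw [D.rho_eq hg hcan, c]
  module

end NonNull

/-! ### Null case: lightlike partner, image and formula for `ψ` -/

section Null

/-- Subtracting `(b²/2) a_i` from a dual vector `b` makes it lightlike without changing its pairing
with `a_i`. -/
lemma exists_nullPartner (hg : g.IsSymm) (hnd : g.Nondegenerate) {i : Fin k} (h : D.kappa i = 0)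
    (ha : D.a i ≠ 0) : ∃ b, D.IsNullPartner i b := by
  obtain ⟨b, hb, hab⟩ := D.exists_dual hnd (D.a_mem i) ha
  have h1 : g (D.a i) (D.a i) = 0 := h
  have h2 : g b (D.a i) = 1 := by rw [← hab, ← hg.eq]
  have h3 : g (D.a i) (b - (g b b / 2) • D.a i) = 1 := by simp [hab, h1]
  refine ⟨b - (g b b / 2) • D.a i, sub_mem hb (Submodule.smul_mem _ _ (D.a_mem i)), ?_, ?_, h3⟩
  · intro h0
    rw [h0, map_zero] at h3
    exact zero_ne_one h3
  · simp [h1, h2, hab]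
    ring

lemma orthProj_W₀Null (hg : g.IsSymm) (hnd : g.Nondegenerate) {i : Fin k} (h : D.kappa i = 0)
    {b : E} (hb : D.IsNullPartner i b) (p : E) :
    orthProj g (D.W₀Null i b) p = D.proj 0 p - g b p • D.a i - g (D.a i) p • b := by
  obtain ⟨hb, -, hbb, hab⟩ := hb
  have h1 : g (D.a i) (D.a i) = 0 := h
  have h2 : g b (D.a i) = 1 := by rw [← hab, ← hg.eq]
  refine orthProj_eq hg hnd (fun p => D.proj 0 p - g b p • D.a i - g (D.a i) p • b)
    (fun p => Submodule.mem_inf.2 ⟨sub_mem (sub_mem (D.proj_mem 0 p)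
      (Submodule.smul_mem _ _ (D.a_mem i))) (Submodule.smul_mem _ _ hb), ?_⟩) (fun q w hw => ?_) p
  · rw [LinearMap.BilinForm.mem_orthogonal_iff]
    intro y hy
    obtain ⟨s, t, rfl⟩ := Submodule.mem_span_pair.1 hy
    change g _ _ = 0
    simp [D.form_proj hb, D.form_proj (D.a_mem i), h1, h2, hab, hbb]
  · have h' : ∀ y ∈ ({D.a i, b} : Set E), g w y = 0 := fun y hy => by
      rw [← hg.eq]
      exact hw.2 _ (Submodule.subset_span hy)
    simp [D.form_proj hw.1, h' (D.a i) (by simp), h' b (by simp)]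

lemma target_of_null (h : D.IsNull) (i : Fin k) : D.target = {p | 0 < g (D.a i) p} := by
  obtain ⟨rfl, h⟩ := h
  ext p
  change (∀ j, _) ↔ 0 < g (D.a i) p
  rw [Unique.forall_iff, Subsingleton.elim i default, radSq, (h _).2]
  simp only [zero_mul, add_zero, true_imp_iff]
  exact ⟨And.right, fun h => ⟨pow_pos h 2, h⟩⟩

/-- Split `p_0` along `W_0`, `a` and `b`, and substitute `s = -u²/2`; the projection of `p_1` to
`V_1` is `u` because `p̄` and `a` lie in `V_0`. -/
lemma psi_of_null (hg : g.IsSymm) (hnd : g.Nondegenerate) (hcan : D.IsCanonical)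
    (h : D.IsNull) {i : Fin k} {b : E} (hb : D.IsNullPartner i b)
    {x : E × (Fin k → E)} (hx : x ∈ D.domain) :
    D.psi x = orthProj g (D.W₀Null i b) x.1
      + (g b x.1 - (1 / 2 : ℝ) * g (D.a i) x.1 *
          g (orthProj g (D.V i.succ) (x.2 i)) (orthProj g (D.V i.succ) (x.2 i))) • D.a i
      + g (D.a i) x.1 • b + g (D.a i) x.1 • orthProj g (D.V i.succ) (x.2 i) := by
  obtain ⟨rfl, h⟩ := h
  obtain ⟨h0, -, u, s, hu, hs, hxu, hpsi⟩ :=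
    D.exists_of_mem_domain hg hcan (fun i => (h i).1) hx
  have h1 : D.proj i.succ (x.2 i) = u i := by
    rw [hxu i, map_add, map_add, map_smul, D.proj_of_mem (hu i),
      D.proj_of_mem_ne (Fin.succ_ne_zero i).symm hcan.1,
      D.proj_of_mem_ne (Fin.succ_ne_zero i).symm (D.a_mem i)]
    simp
  have h2 := hs i
  rw [(h i).2] at h2
  rw [D.orthProj_W₀Null hg hnd (h i).2 hb, D.orthProj_V hg hnd, h1, hpsi, D.proj_of_mem h0,
    Fintype.sum_eq_single i (fun j hj => absurd (Subsingleton.elim j i) hj),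
    show s i = -(1 / 2) * g (u i) (u i) by linarith]
  module

end Null

end InitialData

end WarpedProduct

theorem mainTheorem2 {E : Type*} [NormedAddCommGroup E] [NormedSpace ℝ E] [FiniteDimensional ℝ E]
    (g : LinearMap.BilinForm ℝ E) (hg : g.IsSymm) (hnd : g.Nondegenerate)
    (k : ℕ) (D : WarpedProduct.InitialData g k)
    (hproper : D.IsNonNull ∨ D.IsNull) (hcan : D.IsCanonical) :
    D.N₀ = {p | p ∈ D.V 0 ∧ ∀ i, 0 < g (D.a i) p} ∧
    (∀ i, ∀ p₀ ∈ D.N₀, D.rho i p₀ = g (D.a i) p₀) ∧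
    D.image.Nonempty ∧
    WarpedProduct.IsIsometryOnto g D.warpedMetric D.psi D.domain D.image ∧
    (D.IsNonNull →
      D.image = {p | ∀ i, SignType.sign (g (WarpedProduct.orthProj g (D.W i) p)
          (WarpedProduct.orthProj g (D.W i) p)) = SignType.sign (D.kappa i)} ∧
      ∀ x ∈ D.domain, D.psi x =
        WarpedProduct.orthProj g D.W₀ x.1 + ∑ i, g (D.a i) x.1 • (x.2 i - D.c i)) ∧
    (D.IsNull → ∀ i : Fin k,
      D.image = {p | 0 < g (D.a i) p} ∧
      (∃ b, D.IsNullPartner i b) ∧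
      ∀ b, D.IsNullPartner i b → ∀ x ∈ D.domain, D.psi x =
        WarpedProduct.orthProj g (D.W₀Null i b) x.1
        + (g b x.1 - (1 / 2 : ℝ) * g (D.a i) x.1 *
            g (WarpedProduct.orthProj g (D.V i.succ) (x.2 i))
              (WarpedProduct.orthProj g (D.V i.succ) (x.2 i))) • D.a i
        + g (D.a i) x.1 • b
        + g (D.a i) x.1 • WarpedProduct.orthProj g (D.V i.succ) (x.2 i)) ∧
    ∀ x ∈ D.domain, g (D.psi x) (D.psi x) = g x.1 x.1 := by

  -- This is all that the uniform treatment needs from the case distinction; it excludes the plane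
  -- case of a spherical submanifold.
  have ha : ∀ i, D.a i ≠ 0 := by
    rcases hproper with h | h
    · exact fun i h0 => h i (by simp [WarpedProduct.InitialData.kappa, h0])
    · exact fun i => (h.2 i).1
  have himage := D.image_eq_target hg hcan ha
  refine ⟨D.N₀_eq hg hcan, fun i p _ => D.rho_eq hg hcan i p, D.image_nonempty hg hcan ha, ?_,
    fun h => ⟨himage.trans (D.target_of_nonNull hg hnd h), fun x hx =>
      D.psi_of_nonNull hg hnd hcan h (D.exists_of_mem_domain hg hcan ha hx).1⟩,
    fun h i => ⟨himage.trans (D.target_of_null h i),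
      D.exists_nullPartner hg hnd (h.2 i).2 (ha i), fun b hb x hx =>
      D.psi_of_null hg hnd hcan h hb hx⟩,
    fun x hx => D.psi_sq hg hcan ha hx⟩
  rw [himage]
  exact ⟨D.isOpen_target, D.bijOn_psi hg hcan ha, D.contDiff_psi,
    ⟨D.psiInv, D.contDiffOn_psiInv, D.leftInvOn_psiInv hg hcan ha, D.rightInvOn_psiInv hg hcan⟩,
    fun x hx v w hv hw => D.form_fderiv_psi hg hnd hcan ha hx hv hw⟩
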